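/- Let $K$ be a finite simplicial complex which is the union of nonempty connected subcomplexes $K_1,\dots,K_n$ such that $K_i\cap K_j\cap K_k=\emptyset$ for all pairwise distinct $i,j,k$, and let $F$ be a field. Let $G$ be the simple graph with vertices $v_1,\dots,v_n$ in which $v_i,v_j$ ($i\ne j$) are joined by an edge if and only if $|K_i|\cap|K_j|\neq\emptyset$. Let $G'$ be obtained from $G$ by subdividing each edge $e$ once, by a new vertex $w_e$. View graphs as one-dimensional simplicial complexes, and let $H_1(\cdot\,;F)$ denote first singular homology of the underlying space, with coefficients in $F$. For all choices of points $p_i\in|K_i|$ and, for each edge $e=\{v_i,v_j\}$ of $G$, of points $q_e\in|K_i|\cap|K_j|$, there is a continuous map $f\colon G'\to|K|$ with $f(v_i)=p_i$ and $f(w_e)=q_e$ that maps each edge $\{v_i,w_e\}$ of $G'$ into $|K_i|$. The subdivision map $G'\to G$ (affine on edges, $v_i\mapsto v_i$, $w_e\mapsto$ midpoint of $e$) induces an isomorphism $H_1(G';F)\cong H_1(G;F)$, and for every such $f$ (and every such choice of points) the composite $$H_1(G;F)\cong H_1(G';F)\xrightarrow{\,f_*\,}H_1(|K|;F)$$ is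 injective. In particular, $\operatorname{rank} H_1(|K|;F)\ge\operatorname{rank} H_1(G;F)$. -/

import Mathlib

open CategoryTheory

universe u v

/-! ### Homology -/

/-- The first singular homology `H₁(X; F)` of a topological space `X` with coefficients in the
field `F`. (`ULift` only moves `F` to a universe which also contains the singular simplices.) -/
noncomputable abbrev H1 (F : Type u) [Field F] (X : Type v) [TopologicalSpace X] :
    ModuleCat.{max u v} F :=
  ((AlgebraicTopology.singularHomologyFunctor (ModuleCat.{max u v} F) 1).obj
    (ModuleCat.of F (ULift.{v} F))).obj (TopCat.of X)

/-- The linear map `H₁(X; F) → H₁(Y; F)` induced by a continuous map `X → Y`. -/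
noncomputable abbrev H1map (F : Type u) [Field F] {X Y : Type v} [TopologicalSpace X]
    [TopologicalSpace Y] (f : C(X, Y)) : H1 F X →ₗ[F] H1 F Y :=
  (((AlgebraicTopology.singularHomologyFunctor (ModuleCat.{max u v} F) 1).obj
    (ModuleCat.of F (ULift.{v} F))).map (TopCat.ofHom f)).hom

/-! ### Graphs as topological spaces -/

section Graphs

open scoped Classical

variable {V : Type v}

/-- The point of `V → ℝ` which represents the vertex `a`. -/
noncomputable def vertexPoint (a : V) : V → ℝ := Pi.single a 1

/-- The geometric realization of a graph (viewed as a one-dimensional simplicial complex) with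
finite vertex set `V`: the union of its vertices and of its edges in the standard simplex of
`V → ℝ`. (The degenerate segments `a = b` are the vertices.) -/
def graphSpace (G : SimpleGraph V) : Set (V → ℝ) :=
  {x | ∃ a b, (a = b ∨ G.Adj a b) ∧ x ∈ segment ℝ (vertexPoint a) (vertexPoint b)}

/-- The graph obtained by subdividing each edge of `G` once: there is a new vertex for each edge
`e` of `G`, joined to the two ends of `e`, and there are no other edges. -/
def subdividedGraph (G : SimpleGraph V) : SimpleGraph (V ⊕ G.edgeSet) :=
  SimpleGraph.fromRel fun a b =>
    ∃ (i : V) (e : G.edgeSet), i ∈ (e : Sym2 V) ∧ a = Sum.inl i ∧ b = Sum.inr e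

/-- The affine extension of the map which sends each old vertex to itself, and each new vertex to
the midpoint of the edge which it subdivides. -/
noncomputable def subdivisionFun [Fintype V] (G : SimpleGraph V) (x : V ⊕ G.edgeSet → ℝ) :
    V → ℝ :=
  fun i => x (Sum.inl i) + ∑ e : G.edgeSet, if i ∈ (e : Sym2 V) then x (Sum.inr e) / 2 else 0

theorem subdivisionFun_inl_inr [Fintype V] (G : SimpleGraph V) (i j : V) (h : G.Adj i j)
    (s t : ℝ) :
    subdivisionFun G (s • vertexPoint (Sum.inl i) +
      t • vertexPoint (Sum.inr (⟨s(i, j), h⟩ : G.edgeSet))) =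
      (s + t / 2) • vertexPoint i + (t / 2) • vertexPoint j := by
  have hij := h.ne
  funext k
  simp only [subdivisionFun, vertexPoint, Pi.add_apply, Pi.smul_apply, smul_eq_mul]
  rw [Finset.sum_eq_single (⟨s(i, j), h⟩ : G.edgeSet)]
  · by_cases hi : k = i
    · subst hi; simp [hij]
    · by_cases hj : k = j
      · subst hj; simp [hi]
      · simp [hi, hj]
  · intro e _ he
    simp [he]
  · simp

theorem subdivisionFun_inl [Fintype V] (G : SimpleGraph V) (i : V) :
    subdivisionFun G (vertexPoint (Sum.inl i)) = vertexPoint i := by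
  funext k
  simp [subdivisionFun, vertexPoint, Pi.single_apply]

theorem subdivisionFun_mem_aux [Fintype V] (G : SimpleGraph V) (i : V) (e : G.edgeSet)
    (hi : i ∈ (e : Sym2 V)) (s t : ℝ) (hs : 0 ≤ s) (ht : 0 ≤ t) (hst : s + t = 1) :
    subdivisionFun G (s • vertexPoint (Sum.inl i) + t • vertexPoint (Sum.inr e)) ∈
      graphSpace G := by
  obtain ⟨e, he⟩ := e
  obtain ⟨j, rfl⟩ := hi
  have h : G.Adj i j := he
  rw [subdivisionFun_inl_inr G i j h]
  exact ⟨i, j, Or.inr h, s + t / 2, t / 2, by positivity, by positivity, by linarith, rfl⟩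

theorem subdivisionFun_mem [Fintype V] (G : SimpleGraph V) {x : V ⊕ G.edgeSet → ℝ}
    (hx : x ∈ graphSpace (subdividedGraph G)) : subdivisionFun G x ∈ graphSpace G := by
  obtain ⟨a, b, hab, s, t, hs, ht, hst, rfl⟩ := hx
  rcases hab with rfl | hab
  · rw [← add_smul, hst, one_smul]
    rcases a with i | e
    · rw [subdivisionFun_inl]
      exact ⟨i, i, Or.inl rfl, left_mem_segment ℝ _ _⟩
    · obtain ⟨i, hi⟩ : ∃ i, i ∈ (e : Sym2 V) :=
        ⟨_, Sym2.out_fst_mem _⟩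
      simpa using subdivisionFun_mem_aux G i e hi 0 1 le_rfl zero_le_one (by norm_num)
  · rw [subdividedGraph, SimpleGraph.fromRel_adj] at hab
    obtain ⟨-, ⟨i, e, hi, rfl, rfl⟩ | ⟨i, e, hi, rfl, rfl⟩⟩ := hab
    · exact subdivisionFun_mem_aux G i e hi s t hs ht hst
    · rw [add_comm]
      exact subdivisionFun_mem_aux G i e hi t s ht hs (by linarith)

/-- The canonical continuous map from the subdivided graph to the graph. -/
noncomputable def subdivisionMap [Fintype V] (G : SimpleGraph V) :
    C(graphSpace (subdividedGraph G), graphSpace G) where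
  toFun x := ⟨subdivisionFun G x, subdivisionFun_mem G x.2⟩
  continuous_toFun := by
    refine Continuous.subtype_mk (continuous_pi fun i => ?_) _
    have h : ∀ a : V ⊕ G.edgeSet,
        Continuous fun x : graphSpace (subdividedGraph G) => (x : V ⊕ G.edgeSet → ℝ) a :=
      fun a => (continuous_apply a).comp continuous_subtype_val
    refine Continuous.add (h _) (continuous_finsetSum _ fun e _ => ?_)
    split_ifs
    · exact (h _).div_const 2
    · exact continuous_const

end Graphs

/-! ### The intersection graph of a family of complexes -/

section Intersection

variable {ι E : Type v} [NormedAddCommGroup E] [NormedSpace ℝ E]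

/-- The simple graph on the index set in which distinct `i`, `j` are adjacent if and only if
`|Kᵢ| ∩ |Kⱼ| ≠ ∅`. -/
def intersectionGraph (L : ι → Geometry.SimplicialComplex ℝ E) : SimpleGraph ι where
  Adj i j := i ≠ j ∧ ((L i).space ∩ (L j).space).Nonempty
  symm := ⟨fun _ _ h => ⟨h.1.symm, by rw [Set.inter_comm]; exact h.2⟩⟩
  loopless := ⟨fun _ h => h.1 rfl⟩

/-- The subdivision of the intersection graph, as a topological space. -/
abbrev SubdividedSpace (L : ι → Geometry.SimplicialComplex ℝ E) : Type v :=
  graphSpace (subdividedGraph (intersectionGraph L))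

/-- The vertex `vᵢ` of the subdivided intersection graph. -/
noncomputable def oldVertex (L : ι → Geometry.SimplicialComplex ℝ E) (i : ι) :
    SubdividedSpace L :=
  ⟨vertexPoint (Sum.inl i), Sum.inl i, Sum.inl i, Or.inl rfl, left_mem_segment ℝ _ _⟩

/-- The vertex `w_e` of the subdivided intersection graph. -/
noncomputable def newVertex (L : ι → Geometry.SimplicialComplex ℝ E)
    (e : (intersectionGraph L).edgeSet) : SubdividedSpace L :=
  ⟨vertexPoint (Sum.inr e), Sum.inr e, Sum.inr e, Or.inl rfl, left_mem_segment ℝ _ _⟩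

/-- The continuous maps from the subdivided intersection graph to `|K|` which arise from a choice
of points `pᵢ ∈ |Kᵢ|` and `q_e ∈ |Kᵢ| ∩ |Kⱼ|`, `e = {i, j}`, and of paths from `pᵢ` to `q_e`
in `|Kᵢ|`: the vertex `vᵢ` is sent to `pᵢ`, the vertex `w_e` to `q_e`, and the edge from `vᵢ`
to `w_e` into `|Kᵢ|`. -/
structure IsIntersectionGraphMap {K : Geometry.SimplicialComplex ℝ E}
    (L : ι → Geometry.SimplicialComplex ℝ E) (p : ι → E)
    (q : (intersectionGraph L).edgeSet → E) (f : C(SubdividedSpace L, K.space)) : Prop where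
  map_oldVertex : ∀ i, (f (oldVertex L i) : E) = p i
  map_newVertex : ∀ e, (f (newVertex L e) : E) = q e
  map_edge : ∀ (i : ι) (e : (intersectionGraph L).edgeSet), i ∈ (e : Sym2 ι) →
    ∀ x : SubdividedSpace L,
      (x : ι ⊕ (intersectionGraph L).edgeSet → ℝ) ∈
          segment ℝ (vertexPoint (Sum.inl i)) (vertexPoint (Sum.inr e)) →
        (f x : E) ∈ (L i).space

end Intersection

/-!
The space `|K|` maps back to the graph `G`. The sets `|Kᵢ|` are compact and no three of them meet,
since a common point of three would lie in a common face. So for small `ε` their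
`ε`-neighbourhoods have the same intersection pattern, and the functions `max (ε - d(x, |Kᵢ|)) 0`,
normalised to have sum `1`, are the barycentric coordinates of a map `g : |K| → G`
(`exists_map_to_graphSpace`). It maps `|Kᵢ|` to the closed star of `vᵢ`, and `|Kᵢ| ∩ |Kⱼ|` to the
edge `{vᵢ, vⱼ}`. Hence `g ∘ f` maps each half-edge `[vᵢ, w_e]` to the star of `vᵢ` and each `w_e` to
the edge `e`, and as stars are contractible, `g ∘ f` is homotopic to the subdivision map
`G' → G` (`homotopic_subdivisionMap`). The latter is a homeomorphism (`subdivisionHomeomorph`), so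
by homotopy invariance `g_* ∘ f_*` is an isomorphism on `H₁`, and `f_*` is injective.

The maps `f` exist because a connected finite complex is path connected
(`pathConnectedSpace_space`): paths in the `|Kᵢ|` are glued along the half-edges of `G'`
(`exists_map_of_paths`).
-/

/-! ### First homology as a homotopy functor -/

theorem H1map_id (F : Type u) [Field F] (X : Type v) [TopologicalSpace X] :
    H1map F (ContinuousMap.id X) = LinearMap.id := by
  have h : TopCat.ofHom (ContinuousMap.id X) = 𝟙 (TopCat.of X) := rfl
  simp only [H1map, h, CategoryTheory.Functor.map_id, ModuleCat.hom_id]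

theorem H1map_comp (F : Type u) [Field F] {X Y Z : Type v} [TopologicalSpace X]
    [TopologicalSpace Y] [TopologicalSpace Z] (g : C(Y, Z)) (f : C(X, Y)) :
    H1map F (g.comp f) = H1map F g ∘ₗ H1map F f := by
  have h : TopCat.ofHom (g.comp f) = TopCat.ofHom f ≫ TopCat.ofHom g := rfl
  simp only [H1map, h, CategoryTheory.Functor.map_comp, ModuleCat.hom_comp]

theorem H1map_eq_of_homotopic (F : Type u) [Field F] {X Y : Type v} [TopologicalSpace X]
    [TopologicalSpace Y] {f g : C(X, Y)} (h : f.Homotopic g) : H1map F f = H1map F g := by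
  obtain ⟨H⟩ := h
  let H' : TopCat.Homotopy (TopCat.ofHom f) (TopCat.ofHom g) := H
  exact congrArg ModuleCat.Hom.hom (H'.congr_homologyMap_singularChainComplexFunctor
    (ModuleCat.of F (ULift.{v} F)) 1)

/-- The isomorphism on first homology induced by a homeomorphism. -/
noncomputable def H1equiv (F : Type u) [Field F] {X Y : Type v} [TopologicalSpace X]
    [TopologicalSpace Y] (φ : X ≃ₜ Y) : H1 F X ≃ₗ[F] H1 F Y :=
  LinearEquiv.ofLinearMap (H1map F (φ : C(X, Y))) (H1map F (φ.symm : C(Y, X)))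
    (by rw [← H1map_comp, ← H1map_id]; congr 1; ext; simp)
    (by rw [← H1map_comp, ← H1map_id]; congr 1; ext; simp)

/-! ### Finite unions of cells -/

/-- In a space which is a finite union of closed path-connected pieces, path components are
unions of pieces, hence closed; there are finitely many, so they are open. -/
theorem pathConnectedSpace_of_finite_closed_cover {X κ : Type*} [TopologicalSpace X]
    [ConnectedSpace X] [Finite κ] (C : κ → Set X) (hcl : ∀ k, IsClosed (C k))
    (hcov : ∀ x, ∃ k, x ∈ C k) (hjoin : ∀ k, ∀ x ∈ C k, ∀ y ∈ C k, Joined x y) :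
    PathConnectedSpace X := by
  -- a union of path components is closed; this applies to a component and to its complement
  have key : ∀ Z : Set X, (∀ x ∈ Z, ∀ y, Joined x y → y ∈ Z) → IsClosed Z := by
    intro Z hZ
    have : Z = ⋃ k ∈ {k | (C k ∩ Z).Nonempty}, C k := by
      ext x
      simp only [Set.mem_iUnion, Set.mem_ofPred_eq, exists_prop]
      constructor
      · intro hx
        obtain ⟨k, hk⟩ := hcov x
        exact ⟨k, ⟨x, hk, hx⟩, hk⟩
      · rintro ⟨k, ⟨y, hy, hyZ⟩, hx⟩
        exact hZ y hyZ x (hjoin k y hy x hx)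
    rw [this]
    exact Set.Finite.isClosed_biUnion (Set.toFinite _) fun k _ => hcl k
  refine ⟨inferInstance, fun x y => ?_⟩
  have hclopen : IsClopen (pathComponent x) :=
    ⟨key _ fun y hy z hyz => Joined.trans hy hyz,
      isClosed_compl_iff.1 (key (pathComponent x)ᶜ fun y hy z hyz hz =>
        hy (Joined.trans hz hyz.symm))⟩
  have := hclopen.eq_univ ⟨x, mem_pathComponent_self x⟩
  exact (Set.ext_iff.1 this y).2 (Set.mem_univ y)

section Complexes

variable {E : Type*} [NormedAddCommGroup E] [NormedSpace ℝ E]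

theorem isCompact_space (K : Geometry.SimplicialComplex ℝ E) (hfin : K.faces.Finite) :
    IsCompact K.space :=
  hfin.isCompact_biUnion fun s _ => s.finite_toSet.isCompact_convexHull ℝ

theorem pathConnectedSpace_space (K : Geometry.SimplicialComplex ℝ E) (hfin : K.faces.Finite)
    [ConnectedSpace K.space] : PathConnectedSpace K.space := by
  have : Finite K.faces := hfin
  refine pathConnectedSpace_of_finite_closed_cover
    (fun s : K.faces => ((↑) : K.space → E) ⁻¹' convexHull ℝ ((s : Finset E) : Set E)) ?_ ?_ ?_
  · intro s
    exact ((s : Finset E).finite_toSet.isCompact_convexHull ℝ).isClosed.preimage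
      continuous_subtype_val
  · intro x
    obtain ⟨s, hs, hx⟩ := Geometry.SimplicialComplex.mem_space_iff.1 x.2
    exact ⟨⟨s, hs⟩, hx⟩
  · rintro ⟨s, hs⟩ x hx y hy
    have h : JoinedIn (convexHull ℝ (s : Set E)) (x : E) y :=
      JoinedIn.of_segment_subset ((convex_convexHull ℝ _).segment_subset hx hy)
    exact (joinedIn_iff_joined x.2 y.2).1
      (h.mono (Geometry.SimplicialComplex.convexHull_subset_space hs))

/-- Subcomplexes of `K` without a common face have no common point: faces of `K` through a given
point meet in a face through that point. -/
theorem inter_space_eq_empty {K L₁ L₂ L₃ : Geometry.SimplicialComplex ℝ E}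
    (h₁ : L₁.faces ⊆ K.faces) (h₂ : L₂.faces ⊆ K.faces) (h₃ : L₃.faces ⊆ K.faces)
    (h : L₁ ⊓ L₂ ⊓ L₃ = ⊥) : L₁.space ∩ L₂.space ∩ L₃.space = ∅ := by
  classical
  refine Set.eq_empty_of_forall_notMem fun x hx => ?_
  simp only [Set.mem_inter_iff, Geometry.SimplicialComplex.mem_space_iff] at hx
  obtain ⟨⟨⟨s, hs, hxs⟩, t, ht, hxt⟩, r, hr, hxr⟩ := hx
  have hst : x ∈ convexHull ℝ ((s ∩ t : Finset E) : Set E) := by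
    rw [Finset.coe_inter]
    exact K.inter_subset_convexHull (h₁ hs) (h₂ ht) ⟨hxs, hxt⟩
  have hne : (s ∩ t).Nonempty := by
    exact Finset.coe_nonempty.1 (convexHull_nonempty_iff.1 ⟨x, hst⟩)
  have hst₁ := L₁.down_closed hs Finset.inter_subset_left hne
  have hst₂ := L₂.down_closed ht Finset.inter_subset_right hne
  have hstr : x ∈ convexHull ℝ ((s ∩ t ∩ r : Finset E) : Set E) := by
    rw [Finset.coe_inter]
    exact K.inter_subset_convexHull (h₁ hst₁) (h₃ hr) ⟨hst, hxr⟩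
  have hne' : (s ∩ t ∩ r).Nonempty := by
    exact Finset.coe_nonempty.1 (convexHull_nonempty_iff.1 ⟨x, hstr⟩)
  have hmem : s ∩ t ∩ r ∈ (L₁ ⊓ L₂ ⊓ L₃).faces :=
    ⟨⟨L₁.down_closed hst₁ Finset.inter_subset_left hne',
      L₂.down_closed hst₂ Finset.inter_subset_left hne'⟩,
      L₃.down_closed hr Finset.inter_subset_right hne'⟩
  rw [h] at hmem
  exact hmem

end Complexes

/-- For small `ε`, any sets of the family whose `ε`-neighbourhoods share a point of the compact set
`X` have a common point in `X`. A subfamily without common point in `X` has a positive sum of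
distances, which is bounded below on `X`; there are finitely many subfamilies. -/
theorem exists_common_point_of_infDist_lt {ι E : Type*} [Finite ι] [PseudoMetricSpace E]
    {X : Set E} (hX : IsCompact X) (A : ι → Set E) (hA : ∀ i, IsClosed (A i))
    (hne : ∀ i, (A i).Nonempty) :
    ∃ ε > 0, ∀ x ∈ X, ∃ y ∈ X, ∀ i, Metric.infDist x (A i) < ε → y ∈ A i := by
  have hS : ∀ S : Finset ι, ∃ δ > 0, ∀ ε ≤ δ, ∀ x ∈ X,
      (∀ i ∈ S, Metric.infDist x (A i) < ε) → ∃ y ∈ X, ∀ i ∈ S, y ∈ A i := by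
    intro S
    by_cases hcom : ∃ y ∈ X, ∀ i ∈ S, y ∈ A i
    · exact ⟨1, one_pos, fun _ _ _ _ _ => hcom⟩
    push Not at hcom
    have hpos : ∀ x ∈ X, 0 < ∑ i ∈ S, Metric.infDist x (A i) := by
      intro x hx
      obtain ⟨i, hi, hxi⟩ := hcom x hx
      exact Finset.sum_pos' (fun _ _ => Metric.infDist_nonneg)
        ⟨i, hi, ((hA i).notMem_iff_infDist_pos (hne i)).1 hxi⟩
    obtain ⟨m, hm, hmX⟩ := hX.exists_forall_le' (f := fun x => ∑ i ∈ S, Metric.infDist x (A i))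
      (continuous_finsetSum _ fun i _ => Metric.continuous_infDist_pt _).continuousOn hpos
    refine ⟨m / (S.card + 1), by positivity, fun ε hε x hx hlt => absurd (hmX x hx) (not_le.2 ?_)⟩
    have h1 : ∑ i ∈ S, Metric.infDist x (A i) ≤ S.card * (m / (S.card + 1)) := by
      rw [← nsmul_eq_mul]
      exact Finset.sum_le_card_nsmul _ _ _ fun i hi => (hlt i hi).le.trans hε
    have h2 : (S.card : ℝ) * (m / (S.card + 1)) < m := by
      rw [← mul_div_assoc, div_lt_iff₀ (by positivity)]
      nlinarith
    exact h1.trans_lt h2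
  choose δ hδ hδS using hS
  cases nonempty_fintype ι
  obtain ⟨S₀, hS₀⟩ := Finite.exists_min δ
  refine ⟨δ S₀, hδ S₀, fun x hx => ?_⟩
  classical
  obtain ⟨y, hy, hyS⟩ := hδS (Finset.univ.filter fun i => Metric.infDist x (A i) < δ S₀) (δ S₀)
    (hS₀ _) x hx (by simp)
  exact ⟨y, hy, fun i hi => hyS i (by simpa using hi)⟩

/-! ### Points of graphs -/

section GraphPoints

variable {V : Type v}

@[simp]
theorem vertexPoint_self (a : V) : vertexPoint a a = 1 := by simp [vertexPoint]

theorem vertexPoint_of_ne {a b : V} (h : b ≠ a) : vertexPoint a b = 0 := by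
  simp [vertexPoint, h]

theorem sum_vertexPoint [Fintype V] (a : V) : ∑ c, vertexPoint a c = 1 := by
  simp [vertexPoint]

/-- The segment between two vertices in barycentric coordinates. -/
theorem mem_segment_vertexPoint_iff [Fintype V] {a b : V} {x : V → ℝ} :
    x ∈ segment ℝ (vertexPoint a) (vertexPoint b) ↔
      (∀ c, 0 ≤ x c) ∧ ∑ c, x c = 1 ∧ ∀ c, c ≠ a → c ≠ b → x c = 0 := by
  classical
  constructor
  · rintro ⟨s, t, hs, ht, hst, rfl⟩
    refine ⟨fun c => ?_, ?_, fun c ha hb => ?_⟩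
    · simp only [vertexPoint, Pi.add_apply, Pi.smul_apply, Pi.single_apply, smul_eq_mul]
      split_ifs <;> simp <;> positivity
    · simp [Finset.sum_add_distrib, ← Finset.mul_sum, sum_vertexPoint, hst]
    · simp [vertexPoint_of_ne ha, vertexPoint_of_ne hb]
  · rintro ⟨h0, h1, hx⟩
    by_cases hab : a = b
    · subst hab
      have hxa : x a = 1 := by
        rw [← h1]
        exact (Finset.sum_eq_single a (fun c _ hc => hx c hc hc) (by simp)).symm
      have : x = vertexPoint a := by
        funext c
        by_cases hc : c = a
        · subst hc; simp [hxa]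
        · rw [hx c hc hc, vertexPoint_of_ne hc]
      rw [this]
      exact left_mem_segment ℝ _ _
    · have hsum : x a + x b = 1 := by
        rw [← h1]
        exact (Fintype.sum_eq_add a b hab fun c hc => hx c hc.1 hc.2).symm
      refine ⟨x a, x b, h0 a, h0 b, hsum, ?_⟩
      funext c
      by_cases ha : c = a
      · subst ha; simp [vertexPoint_of_ne hab]
      · by_cases hb : c = b
        · subst hb; simp [vertexPoint_of_ne ha]
        · simp [vertexPoint_of_ne ha, vertexPoint_of_ne hb, hx c ha hb]

theorem isCompact_segment_vertexPoint (a b : V) :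
    IsCompact (segment ℝ (vertexPoint a) (vertexPoint b)) := by
  rw [← convexHull_pair]
  exact (Set.toFinite _).isCompact_convexHull ℝ

instance compactSpace_graphSpace [Finite V] (G : SimpleGraph V) : CompactSpace (graphSpace G) := by
  refine isCompact_iff_compactSpace.1 ?_
  have : graphSpace G = ⋃ p ∈ {p : V × V | p.1 = p.2 ∨ G.Adj p.1 p.2},
      segment ℝ (vertexPoint p.1) (vertexPoint p.2) := by
    ext x
    simp only [graphSpace, Set.mem_ofPred_eq, Set.mem_iUnion, exists_prop, Prod.exists]
  rw [this]
  exact (Set.toFinite _).isCompact_biUnion fun p _ => isCompact_segment_vertexPoint _ _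

/-- Two maps into a graph whose values at each point lie on a common edge are homotopic, by the
straight-line homotopy along the edges. -/
theorem homotopic_of_common_edge {X : Type*} [TopologicalSpace X] {G : SimpleGraph V}
    (f g : C(X, graphSpace G))
    (h : ∀ x, ∃ a b, (a = b ∨ G.Adj a b) ∧
      (f x : V → ℝ) ∈ segment ℝ (vertexPoint a) (vertexPoint b) ∧
      (g x : V → ℝ) ∈ segment ℝ (vertexPoint a) (vertexPoint b)) : f.Homotopic g := by
  refine ⟨{ toFun := fun p => ⟨(1 - (p.1 : ℝ)) • (f p.2 : V → ℝ) + (p.1 : ℝ) • (g p.2 : V → ℝ), ?_⟩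
            continuous_toFun := ?_
            map_zero_left := ?_
            map_one_left := ?_ }⟩
  · obtain ⟨a, b, hab, hf, hg⟩ := h p.2
    exact ⟨a, b, hab, convex_segment _ _ hf hg (by linarith [p.1.2.2]) p.1.2.1 (by ring)⟩
  · fun_prop
  · intro x; ext; simp
  · intro x; ext; simp

end GraphPoints

/-! ### The subdivided graph -/

section Subdivision

variable {V : Type v} {G : SimpleGraph V}

theorem subdividedGraph_adj_inl_inr {i : V} {e : G.edgeSet} :
    (subdividedGraph G).Adj (Sum.inl i) (Sum.inr e) ↔ i ∈ (e : Sym2 V) := by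
  simp only [subdividedGraph, SimpleGraph.fromRel_adj]
  constructor
  · rintro ⟨-, ⟨i', e', h, h1, h2⟩ | ⟨i', e', h, h1, h2⟩⟩
    · cases h1; cases h2; exact h
    · cases h1
  · intro h
    exact ⟨by simp, Or.inl ⟨i, e, h, rfl, rfl⟩⟩

/-- A point of the subdivided graph is an old vertex or lies on a half-edge `[vᵢ, w_e]`. -/
theorem mem_graphSpace_subdividedGraph_iff {x : V ⊕ G.edgeSet → ℝ} :
    x ∈ graphSpace (subdividedGraph G) ↔ (∃ i, x = vertexPoint (Sum.inl i)) ∨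
      ∃ (i : V) (e : G.edgeSet), i ∈ (e : Sym2 V) ∧
        x ∈ segment ℝ (vertexPoint (Sum.inl i)) (vertexPoint (Sum.inr e)) := by
  constructor
  · rintro ⟨a, b, rfl | hab, hx⟩
    · rw [segment_same, Set.mem_singleton_iff] at hx
      rcases a with i | e
      · exact Or.inl ⟨i, hx⟩
      · exact Or.inr ⟨_, e, Sym2.out_fst_mem _, hx ▸ right_mem_segment ℝ _ _⟩
    · rcases a with i | e <;> rcases b with j | e'
      · simp [subdividedGraph] at hab
      · exact Or.inr ⟨i, e', subdividedGraph_adj_inl_inr.1 hab, hx⟩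
      · exact Or.inr ⟨j, e, subdividedGraph_adj_inl_inr.1 hab.symm, by rwa [segment_symm]⟩
      · simp [subdividedGraph] at hab
  · rintro (⟨i, rfl⟩ | ⟨i, e, h, hx⟩)
    · exact ⟨_, _, Or.inl rfl, left_mem_segment ℝ _ _⟩
    · exact ⟨_, _, Or.inr (subdividedGraph_adj_inl_inr.2 h), hx⟩

/-- The half-edge `[vᵢ, w_e]` in barycentric coordinates. -/
theorem mem_halfEdge_iff {i : V} {e : G.edgeSet} {x : V ⊕ G.edgeSet → ℝ} :
    x ∈ segment ℝ (vertexPoint (Sum.inl i)) (vertexPoint (Sum.inr e)) ↔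
    0 ≤ x (Sum.inr e) ∧ x (Sum.inr e) ≤ 1 ∧ x (Sum.inl i) = 1 - x (Sum.inr e) ∧
      (∀ j, j ≠ i → x (Sum.inl j) = 0) ∧ ∀ e', e' ≠ e → x (Sum.inr e') = 0 := by
  have h1 : vertexPoint (V := V ⊕ G.edgeSet) (Sum.inl i) (Sum.inr e) = 0 :=
    vertexPoint_of_ne (by simp)
  have h2 : vertexPoint (V := V ⊕ G.edgeSet) (Sum.inr e) (Sum.inl i) = 0 :=
    vertexPoint_of_ne (by simp)
  have h3 : ∀ j, j ≠ i → vertexPoint (V := V ⊕ G.edgeSet) (Sum.inl i) (Sum.inl j) = 0 :=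
    fun j hj => vertexPoint_of_ne (by simpa)
  have h4 : ∀ j, vertexPoint (V := V ⊕ G.edgeSet) (Sum.inr e) (Sum.inl j) = 0 :=
    fun j => vertexPoint_of_ne (by simp)
  have h5 : ∀ e', vertexPoint (V := V ⊕ G.edgeSet) (Sum.inl i) (Sum.inr e') = 0 :=
    fun e' => vertexPoint_of_ne (by simp)
  have h6 : ∀ e', e' ≠ e → vertexPoint (V := V ⊕ G.edgeSet) (Sum.inr e) (Sum.inr e') = 0 :=
    fun e' he => vertexPoint_of_ne (by simpa)
  constructor
  · rintro ⟨s, t, hs, ht, hst, rfl⟩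
    exact ⟨by simpa [h1], by simp [h1]; linarith, by simp [h1, h2]; linarith,
      fun j hj => by simp [h3 j hj, h4], fun e' he => by simp [h5, h6 e' he]⟩
  · rintro ⟨h0, h1, hi, hl, hr⟩
    refine ⟨1 - x (Sum.inr e), x (Sum.inr e), by linarith, h0, by ring, ?_⟩
    funext c
    rcases c with j | e'
    · by_cases hj : j = i
      · subst hj; simp [h2, hi]
      · simp [h3 j hj, h4, hl j hj]
    · by_cases he : e' = e
      · subst he; simp [h5]
      · simp [h5, h6 e' he, hr e' he]

/-- On a half-edge of the subdivision of `{i, j}`, the subdivision map in coordinates. -/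
theorem subdivisionFun_eq_of_mem_halfEdge [Fintype V] {i j : V} (h : G.Adj i j)
    {x : V ⊕ G.edgeSet → ℝ} (hx : x ∈ segment ℝ (vertexPoint (Sum.inl i))
      (vertexPoint (Sum.inr (⟨s(i, j), h⟩ : G.edgeSet)))) :
    subdivisionFun G x = (1 - x (Sum.inr ⟨s(i, j), h⟩) / 2) • vertexPoint i +
      (x (Sum.inr ⟨s(i, j), h⟩) / 2) • vertexPoint j := by
  obtain ⟨s, t, hs, ht, hst, rfl⟩ := hx
  have h1 : vertexPoint (V := V ⊕ G.edgeSet) (Sum.inl i) (Sum.inr ⟨s(i, j), h⟩) = 0 :=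
    vertexPoint_of_ne (by simp)
  rw [subdivisionFun_inl_inr]
  simp only [Pi.add_apply, Pi.smul_apply, h1, vertexPoint_self, smul_eq_mul, mul_zero, mul_one,
    zero_add]
  congr 2
  linarith

theorem subdivisionFun_mem_segment [Fintype V] {i j : V} (h : G.Adj i j)
    {x : V ⊕ G.edgeSet → ℝ} (hx : x ∈ segment ℝ (vertexPoint (Sum.inl i))
      (vertexPoint (Sum.inr (⟨s(i, j), h⟩ : G.edgeSet)))) :
    subdivisionFun G x ∈ segment ℝ (vertexPoint i) (vertexPoint j) := by
  obtain ⟨h0, h1, -⟩ := mem_halfEdge_iff.1 hx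
  rw [subdivisionFun_eq_of_mem_halfEdge h hx]
  exact ⟨_, _, by linarith, by linarith, by ring, rfl⟩

/-- The new coordinates of a point of the subdivided graph are determined by its image. -/
theorem inr_eq_two_mul_min [Fintype V] {x : V ⊕ G.edgeSet → ℝ}
    (hx : x ∈ graphSpace (subdividedGraph G)) {a b : V} (hab : G.Adj a b) :
    x (Sum.inr ⟨s(a, b), hab⟩) = 2 * min (subdivisionFun G x a) (subdivisionFun G x b) := by
  rcases mem_graphSpace_subdividedGraph_iff.1 hx with ⟨i, rfl⟩ | ⟨i, ⟨e, he⟩, hi, hxe⟩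
  · rw [subdivisionFun_inl, vertexPoint_of_ne (by simp)]
    by_cases ha : a = i
    · subst ha
      simp [vertexPoint_of_ne hab.ne']
    · by_cases hb : b = i
      · subst hb; simp [vertexPoint_of_ne hab.ne]
      · simp [vertexPoint_of_ne ha, vertexPoint_of_ne hb]
  · obtain ⟨j, rfl⟩ := hi
    have hij : G.Adj i j := he
    obtain ⟨h0, h1, -, -, h4⟩ := mem_halfEdge_iff.1 hxe
    rw [subdivisionFun_eq_of_mem_halfEdge hij hxe]
    set t := x (Sum.inr ⟨s(i, j), he⟩) with ht
    have hval : ∀ c, ((1 - t / 2) • vertexPoint i + (t / 2) • vertexPoint j : V → ℝ) c =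
        (1 - t / 2) * vertexPoint i c + t / 2 * vertexPoint j c := fun c => by simp
    rw [hval, hval]
    by_cases heq : s(a, b) = s(i, j)
    · have : x (Sum.inr ⟨s(a, b), hab⟩) = t := by rw [ht]; congr 2; exact Subtype.ext heq
      rw [this]
      rcases Sym2.eq_iff.1 heq with ⟨rfl, rfl⟩ | ⟨rfl, rfl⟩
      · rw [vertexPoint_self, vertexPoint_self, vertexPoint_of_ne hij.ne,
          vertexPoint_of_ne hij.ne', min_eq_right (by linarith)]
        ring
      · rw [vertexPoint_self, vertexPoint_self, vertexPoint_of_ne hij.ne,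
          vertexPoint_of_ne hij.ne', min_eq_left (by linarith)]
        ring
    · rw [h4 _ (fun h => heq (congrArg Subtype.val h))]
      have hnn : ∀ c, 0 ≤ (1 - t / 2) * vertexPoint i c + t / 2 * vertexPoint j c := by
        intro c
        have := (mem_segment_vertexPoint_iff.1
          (subdivisionFun_mem_segment hij hxe)).1 c
        rwa [subdivisionFun_eq_of_mem_halfEdge hij hxe, hval] at this
      have hz : ∀ c, c ≠ i → c ≠ j →
          (1 - t / 2) * vertexPoint i c + t / 2 * vertexPoint j c = 0 := fun c hi hj => by
        simp [vertexPoint_of_ne hi, vertexPoint_of_ne hj]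
      have hor : (a ≠ i ∧ a ≠ j) ∨ (b ≠ i ∧ b ≠ j) := by
        have := hab.ne
        by_contra hcon
        apply heq
        rw [Sym2.eq_iff]
        grind
      rcases hor with ⟨h1, h2⟩ | ⟨h1, h2⟩
      · rw [hz _ h1 h2, min_eq_left (hnn _), mul_zero]
      · rw [hz _ h1 h2, min_eq_right (hnn _), mul_zero]

theorem subdivisionMap_injective [Fintype V] : Function.Injective (subdivisionMap G) := by
  intro x y hxy
  have hval : subdivisionFun G x = subdivisionFun G y := congrArg Subtype.val hxy
  have hr : ∀ e : G.edgeSet, (x : V ⊕ G.edgeSet → ℝ) (Sum.inr e) =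
      (y : V ⊕ G.edgeSet → ℝ) (Sum.inr e) := by
    rintro ⟨⟨a, b⟩, h⟩
    have hab : G.Adj a b := h
    exact (inr_eq_two_mul_min x.2 hab).trans
      ((congrArg (fun z : V → ℝ => 2 * min (z a) (z b)) hval).trans
        (inr_eq_two_mul_min y.2 hab).symm)
  apply Subtype.ext
  funext c
  rcases c with i | e
  · have := congrFun hval i
    simpa only [subdivisionFun, hr, add_left_inj] using this
  · exact hr e

theorem subdivisionMap_surjective [Fintype V] : Function.Surjective (subdivisionMap G) := by
  have half : ∀ (i j : V) (h : G.Adj i j) (t : ℝ), 0 ≤ t → t ≤ 1 →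
      ∃ x ∈ graphSpace (subdividedGraph G),
        subdivisionFun G x = (1 - t / 2) • vertexPoint i + (t / 2) • vertexPoint j := by
    intro i j h t h0 h1
    refine ⟨(1 - t) • vertexPoint (Sum.inl i) +
      t • vertexPoint (Sum.inr (⟨s(i, j), h⟩ : G.edgeSet)),
      ⟨_, _, Or.inr (subdividedGraph_adj_inl_inr.2 (Sym2.mem_mk_left i j)), _, _,
        by linarith, h0, by ring, rfl⟩, ?_⟩
    rw [subdivisionFun_inl_inr]
    congr 2
    ring
  rintro ⟨y, a, b, hab | hab, hy⟩
  · subst hab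
    rw [segment_same, Set.mem_singleton_iff] at hy
    subst hy
    exact ⟨⟨_, mem_graphSpace_subdividedGraph_iff.2 (Or.inl ⟨a, rfl⟩)⟩,
      Subtype.ext (subdivisionFun_inl G a)⟩
  · obtain ⟨s, t, hs, ht, hst, rfl⟩ := hy
    rcases le_total t s with h | h
    · obtain ⟨x, hx, hxe⟩ := half a b hab (2 * t) (by linarith) (by linarith)
      refine ⟨⟨x, hx⟩, Subtype.ext (hxe.trans ?_)⟩
      congr 2 <;> linarith
    · obtain ⟨x, hx, hxe⟩ := half b a hab.symm (2 * s) (by linarith) (by linarith)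
      refine ⟨⟨x, hx⟩, Subtype.ext (hxe.trans ?_)⟩
      rw [add_comm]
      congr 2 <;> linarith

/-- The subdivision map is a homeomorphism: it is a continuous bijection from a compact space to
a Hausdorff space. -/
noncomputable def subdivisionHomeomorph [Fintype V] (G : SimpleGraph V) :
    graphSpace (subdividedGraph G) ≃ₜ graphSpace G :=
  Continuous.homeoOfEquivCompactToT2
    (f := Equiv.ofBijective (subdivisionMap G)
      ⟨subdivisionMap_injective, subdivisionMap_surjective⟩) (subdivisionMap G).continuous

end Subdivision

/-! ### Maps homotopic to the subdivision map -/

section Homotopy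

variable {V : Type v} {G : SimpleGraph V}

/-- In coordinates, the self-map of the subdivided graph which collapses the half of each
half-edge `[vᵢ, w_e]` next to `w_e` to `w_e`, and stretches the other half over `[vᵢ, w_e]`. -/
noncomputable def stretchFun (x : V ⊕ G.edgeSet → ℝ) : V ⊕ G.edgeSet → ℝ :=
  Sum.elim (fun i => max (2 * x (Sum.inl i) - 1) 0) fun e => min (2 * x (Sum.inr e)) 1

theorem stretchFun_vertexPoint_inl (i : V) :
    stretchFun (G := G) (vertexPoint (Sum.inl i)) = vertexPoint (Sum.inl i) := by
  funext c
  rcases c with j | e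
  · by_cases hj : j = i
    · subst hj; simp [stretchFun]; norm_num
    · have : vertexPoint (V := V ⊕ G.edgeSet) (Sum.inl i) (Sum.inl j) = 0 :=
        vertexPoint_of_ne (by simpa)
      simp [stretchFun, this]
  · have : vertexPoint (V := V ⊕ G.edgeSet) (Sum.inl i) (Sum.inr e) = 0 :=
      vertexPoint_of_ne (by simp)
    simp [stretchFun, this]

theorem stretchFun_mem_halfEdge {i : V} {e : G.edgeSet} {x : V ⊕ G.edgeSet → ℝ}
    (hx : x ∈ segment ℝ (vertexPoint (Sum.inl i)) (vertexPoint (Sum.inr e))) :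
    stretchFun x ∈ segment ℝ (vertexPoint (Sum.inl i)) (vertexPoint (Sum.inr e)) := by
  obtain ⟨h0, h1, hi, hl, hr⟩ := mem_halfEdge_iff.1 hx
  refine mem_halfEdge_iff.2 ⟨?_, min_le_right _ _, ?_, fun j hj => ?_, fun e' he' => ?_⟩
  · exact le_min (by linarith) zero_le_one
  · simp only [stretchFun, Sum.elim_inl, Sum.elim_inr, hi]
    rcases le_total (2 * x (Sum.inr e)) 1 with h | h
    · rw [min_eq_left h, max_eq_left (by linarith)]; ring
    · rw [min_eq_right h, max_eq_right (by linarith)]; ring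
  · simp [stretchFun, hl j hj]
  · simp [stretchFun, hr e' he']

theorem stretchFun_eq_vertexPoint_inr {i : V} {e : G.edgeSet} {x : V ⊕ G.edgeSet → ℝ}
    (hx : x ∈ segment ℝ (vertexPoint (Sum.inl i)) (vertexPoint (Sum.inr e)))
    (h : 1 / 2 ≤ x (Sum.inr e)) : stretchFun x = vertexPoint (Sum.inr e) := by
  have h1 : stretchFun x (Sum.inr e) = 1 := min_eq_right (by linarith)
  obtain ⟨s, t, hs, ht, hst, hst'⟩ := stretchFun_mem_halfEdge hx
  have h2 : vertexPoint (V := V ⊕ G.edgeSet) (Sum.inl i) (Sum.inr e) = 0 :=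
    vertexPoint_of_ne (by simp)
  rw [← hst'] at h1
  simp only [Pi.add_apply, Pi.smul_apply, h2, vertexPoint_self, smul_eq_mul, mul_zero, mul_one,
    zero_add] at h1
  rw [← hst', h1, show s = 0 by linarith, zero_smul, one_smul, zero_add]

theorem stretchFun_mem {x : V ⊕ G.edgeSet → ℝ} (hx : x ∈ graphSpace (subdividedGraph G)) :
    stretchFun x ∈ graphSpace (subdividedGraph G) := by
  rw [mem_graphSpace_subdividedGraph_iff] at hx ⊢
  rcases hx with ⟨i, rfl⟩ | ⟨i, e, hi, hx⟩
  · exact Or.inl ⟨i, stretchFun_vertexPoint_inl i⟩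
  · exact Or.inr ⟨i, e, hi, stretchFun_mem_halfEdge hx⟩

/-- The self-map of the subdivided graph which collapses the half of each half-edge `[vᵢ, w_e]`
next to `w_e` to `w_e`, and stretches the other half over `[vᵢ, w_e]`. -/
noncomputable def stretchMap (G : SimpleGraph V) :
    C(graphSpace (subdividedGraph G), graphSpace (subdividedGraph G)) where
  toFun x := ⟨stretchFun x, stretchFun_mem x.2⟩
  continuous_toFun := by
    refine Continuous.subtype_mk (continuous_pi fun c => ?_) _
    have h : ∀ a : V ⊕ G.edgeSet, Continuous fun x : graphSpace (subdividedGraph G) =>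
        (x : V ⊕ G.edgeSet → ℝ) a :=
      fun a => (continuous_apply a).comp continuous_subtype_val
    rcases c with i | e
    · exact (((h _).const_mul 2).sub continuous_const).max continuous_const
    · exact ((h _).const_mul 2).min continuous_const

theorem stretchMap_homotopic_id (G : SimpleGraph V) :
    (stretchMap G).Homotopic (ContinuousMap.id _) := by
  refine homotopic_of_common_edge _ _ fun x => ?_
  rcases mem_graphSpace_subdividedGraph_iff.1 x.2 with ⟨i, hx⟩ | ⟨i, e, hi, hx⟩
  · refine ⟨Sum.inl i, Sum.inl i, Or.inl rfl, ?_, hx ▸ left_mem_segment ℝ _ _⟩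
    change stretchFun (x : V ⊕ G.edgeSet → ℝ) ∈ _
    rw [hx, stretchFun_vertexPoint_inl]
    exact left_mem_segment ℝ _ _
  · exact ⟨_, _, Or.inr (subdividedGraph_adj_inl_inr.2 hi), stretchFun_mem_halfEdge hx, hx⟩

/-- The vector `∑ᵢ min(2 xᵢ, 1) vᵢ`: it is `vᵢ` on the half of `[vᵢ, w_e]` next to `vᵢ`, and
decreases to `0` on the other half. As a partial barycentric combination, it pulls points of the
star of `vᵢ` towards `vᵢ`. -/
noncomputable def pull (x : V ⊕ G.edgeSet → ℝ) : V → ℝ :=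
  fun i => min (2 * x (Sum.inl i)) 1

theorem pull_vertexPoint_inl (i : V) :
    pull (G := G) (vertexPoint (Sum.inl i)) = vertexPoint i := by
  funext j
  by_cases hj : j = i
  · subst hj; simp [pull]
  · have : vertexPoint (V := V ⊕ G.edgeSet) (Sum.inl i) (Sum.inl j) = 0 :=
      vertexPoint_of_ne (by simpa)
    simp [pull, this, vertexPoint_of_ne hj]

theorem pull_of_mem_halfEdge {i : V} {e : G.edgeSet} {x : V ⊕ G.edgeSet → ℝ}
    (hx : x ∈ segment ℝ (vertexPoint (Sum.inl i)) (vertexPoint (Sum.inr e))) :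
    pull x = min (2 * (1 - x (Sum.inr e))) 1 • vertexPoint i := by
  obtain ⟨h0, h1, hi, hl, hr⟩ := mem_halfEdge_iff.1 hx
  funext j
  by_cases hj : j = i
  · subst hj; simp [pull, hi]
  · simp [pull, hl j hj, vertexPoint_of_ne hj]

/-- A map `h` from the subdivided graph to the graph is homotopic to the subdivision map if it
maps each half-edge at `vᵢ` to the closed star of `vᵢ` and the midpoint of each edge to that edge.
The homotopy passes through `h ∘ r`, where `r` is `stretchMap`, and then through the map which is
`vᵢ` on the first half of each half-edge `[vᵢ, w_e]` and runs straight from `vᵢ` to `h w_e` on the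
second half. The values of successive maps at each point lie on a common edge. -/
theorem homotopic_subdivisionMap [Fintype V]
    (h : C(graphSpace (subdividedGraph G), graphSpace G))
    (hold : ∀ (x : graphSpace (subdividedGraph G)) (i : V),
      ((x : V ⊕ G.edgeSet → ℝ) = vertexPoint (Sum.inl i) ∨ ∃ e : G.edgeSet, i ∈ (e : Sym2 V) ∧
        (x : V ⊕ G.edgeSet → ℝ) ∈
          segment ℝ (vertexPoint (Sum.inl i)) (vertexPoint (Sum.inr e))) →
      ∃ j, (i = j ∨ G.Adj i j) ∧ (h x : V → ℝ) ∈ segment ℝ (vertexPoint i) (vertexPoint j))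
    (hnew : ∀ (x : graphSpace (subdividedGraph G)) (i j : V) (hij : G.Adj i j),
      (x : V ⊕ G.edgeSet → ℝ) = vertexPoint (Sum.inr ⟨s(i, j), hij⟩) →
      (h x : V → ℝ) ∈ segment ℝ (vertexPoint i) (vertexPoint j)) :
    h.Homotopic (subdivisionMap G) := by
  let k : graphSpace (subdividedGraph G) → V → ℝ := fun x =>
    (1 - ∑ i, pull (G := G) x i) • (h (stretchMap G x) : V → ℝ) + pull (G := G) x
  have key : ∀ x, (∃ a b, (a = b ∨ G.Adj a b) ∧
        (h (stretchMap G x) : V → ℝ) ∈ segment ℝ (vertexPoint a) (vertexPoint b) ∧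
        k x ∈ segment ℝ (vertexPoint a) (vertexPoint b)) ∧
      ∃ a b, (a = b ∨ G.Adj a b) ∧ k x ∈ segment ℝ (vertexPoint a) (vertexPoint b) ∧
        subdivisionFun G x ∈ segment ℝ (vertexPoint a) (vertexPoint b) := by
    intro x
    rcases mem_graphSpace_subdividedGraph_iff.1 x.2 with ⟨i, hx⟩ | ⟨i, ⟨e, he⟩, hi, hx⟩
    · have hk : k x = vertexPoint i := by
        simp only [k, hx, pull_vertexPoint_inl, sum_vertexPoint, sub_self, zero_smul, zero_add]
      have hr : (stretchMap G x : V ⊕ G.edgeSet → ℝ) = vertexPoint (Sum.inl i) := by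
        change stretchFun (x : V ⊕ G.edgeSet → ℝ) = _
        rw [hx, stretchFun_vertexPoint_inl]
      obtain ⟨j, hij, hj⟩ := hold _ i (Or.inl hr)
      rw [hk, hx, subdivisionFun_inl]
      exact ⟨⟨i, j, hij, hj, left_mem_segment ℝ _ _⟩,
        i, i, Or.inl rfl, left_mem_segment ℝ _ _, left_mem_segment ℝ _ _⟩
    · obtain ⟨h0, h1, -⟩ := mem_halfEdge_iff.1 hx
      have hr : (stretchMap G x : V ⊕ G.edgeSet → ℝ) ∈
          segment ℝ (vertexPoint (Sum.inl i)) (vertexPoint (Sum.inr ⟨e, he⟩)) :=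
        stretchFun_mem_halfEdge hx
      have hpull := pull_of_mem_halfEdge hx
      have hsum : ∑ c, pull (x : V ⊕ G.edgeSet → ℝ) c =
          min (2 * (1 - (x : V ⊕ G.edgeSet → ℝ) (Sum.inr ⟨e, he⟩))) 1 := by
        rw [hpull]
        simp [← Finset.mul_sum, sum_vertexPoint]
      obtain ⟨j, rfl⟩ := hi
      have hij : G.Adj i j := he
      have hσ := subdivisionFun_mem_segment hij hx
      rcases le_total ((x : V ⊕ G.edgeSet → ℝ) (Sum.inr ⟨s(i, j), he⟩)) (1 / 2) with ht | ht
      · have hk : k x = vertexPoint i := by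
          simp only [k]
          rw [hsum, hpull, min_eq_right (by linarith), sub_self, zero_smul, one_smul, zero_add]
        obtain ⟨j', hij', hj'⟩ := hold _ i (Or.inr ⟨_, Sym2.mem_mk_left i j, hr⟩)
        rw [hk]
        exact ⟨⟨i, j', hij', hj', left_mem_segment ℝ _ _⟩,
          i, j, Or.inr hij, left_mem_segment ℝ _ _, hσ⟩
      · have hw := hnew (stretchMap G x) i j hij (stretchFun_eq_vertexPoint_inr hx ht)
        have hk : k x ∈ segment ℝ (vertexPoint i) (vertexPoint j) := by
          simp only [k]
          rw [hsum, hpull, min_eq_left (by linarith)]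
          exact convex_segment _ _ hw (left_mem_segment ℝ _ _) (by linarith) (by linarith)
            (by ring)
        exact ⟨⟨i, j, Or.inr hij, hw, hk⟩, i, j, Or.inr hij, hk, hσ⟩
  let kmap : C(graphSpace (subdividedGraph G), graphSpace G) :=
    { toFun x := ⟨k x, by obtain ⟨⟨a, b, hab, -, hk⟩, -⟩ := key x; exact ⟨a, b, hab, hk⟩⟩
      continuous_toFun := by
        have hp : Continuous fun x : graphSpace (subdividedGraph G) =>
            pull (G := G) (x : V ⊕ G.edgeSet → ℝ) :=
          continuous_pi fun i => (((continuous_apply (Sum.inl i)).comp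
            continuous_subtype_val).const_mul 2).min continuous_const
        have hs : Continuous fun x : graphSpace (subdividedGraph G) =>
            1 - ∑ i, pull (G := G) x i :=
          continuous_const.sub (continuous_finsetSum _ fun i _ => (continuous_apply i).comp hp)
        have hh : Continuous fun x => (h (stretchMap G x) : V → ℝ) :=
          continuous_subtype_val.comp (h.continuous.comp (stretchMap G).continuous)
        exact Continuous.subtype_mk ((hs.smul hh).add hp) _ }
  have e1 : (h.comp (stretchMap G)).Homotopic (h.comp (ContinuousMap.id _)) :=
    ContinuousMap.Homotopic.comp (ContinuousMap.Homotopic.refl h) (stretchMap_homotopic_id G)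
  rw [ContinuousMap.comp_id] at e1
  have e2 : (h.comp (stretchMap G)).Homotopic kmap :=
    homotopic_of_common_edge _ _ fun x => (key x).1
  have e3 : kmap.Homotopic (subdivisionMap G) :=
    homotopic_of_common_edge _ _ fun x => (key x).2
  exact e1.symm.trans (e2.trans e3)

end Homotopy

/-! ### The map to the intersection graph -/

/-- Finitely many closed sets without triple intersections which cover a compact set `X` give a map
from `X` to their intersection graph: a point is sent to the point whose barycentric coordinates
are proportional to `max (ε - infDist x (A i)) 0`. For `ε` small enough, the `ε`-neighbourhoods
intersect like the sets themselves. -/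
theorem exists_map_to_graphSpace {ι : Type v} [Fintype ι] {E : Type*} [PseudoMetricSpace E]
    {X : Set E} (hX : IsCompact X) (A : ι → Set E) (hA : ∀ i, IsClosed (A i))
    (hne : ∀ i, (A i).Nonempty) (hcov : X ⊆ ⋃ i, A i)
    (htriple : ∀ i j k, i ≠ j → i ≠ k → j ≠ k → A i ∩ A j ∩ A k = ∅)
    (G : SimpleGraph ι) (hG : ∀ i j, i ≠ j → (A i ∩ A j).Nonempty → G.Adj i j) :
    ∃ g : C(X, graphSpace G),
      (∀ (x : X) (i : ι), (x : E) ∈ A i → ∃ j, (i = j ∨ G.Adj i j) ∧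
        (g x : ι → ℝ) ∈ segment ℝ (vertexPoint i) (vertexPoint j)) ∧
      ∀ (x : X) (i j : ι), i ≠ j → (x : E) ∈ A i → (x : E) ∈ A j →
        (g x : ι → ℝ) ∈ segment ℝ (vertexPoint i) (vertexPoint j) := by
  obtain ⟨ε, hε, hcommon⟩ := exists_common_point_of_infDist_lt hX A hA hne
  let φ : ι → X → ℝ := fun i x => max (ε - Metric.infDist (x : E) (A i)) 0
  let S : X → ℝ := fun x => ∑ i, φ i x
  let w : X → ι → ℝ := fun x i => φ i x / S x
  have hφ0 : ∀ i x, 0 ≤ φ i x := fun i x => le_max_right _ _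
  have hφlt : ∀ i x, φ i x ≠ 0 → Metric.infDist (x : E) (A i) < ε := by
    intro i x h
    by_contra hcon
    exact h (max_eq_right (by linarith))
  have hφA : ∀ i (x : X), (x : E) ∈ A i → φ i x ≠ 0 := by
    intro i x hx
    have : φ i x = ε := by
      simp only [φ, Metric.infDist_zero_of_mem hx, sub_zero]
      exact max_eq_left hε.le
    rw [this]
    exact hε.ne'
  have hS : ∀ x, 0 < S x := by
    intro x
    obtain ⟨i, hi⟩ := Set.mem_iUnion.1 (hcov x.2)
    exact Finset.sum_pos' (fun i _ => hφ0 i x)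
      ⟨i, Finset.mem_univ _, (hφ0 i x).lt_of_ne' (hφA i x hi)⟩
  have hseg : ∀ x a b, (∀ c, c ≠ a → c ≠ b → φ c x = 0) →
      w x ∈ segment ℝ (vertexPoint a) (vertexPoint b) := by
    intro x a b h
    refine mem_segment_vertexPoint_iff.2
      ⟨fun c => div_nonneg (hφ0 c x) (hS x).le, ?_, fun c ha hb => ?_⟩
    · rw [← Finset.sum_div]
      exact div_self (hS x).ne'
    · simp only [w, h c ha hb, zero_div]
  have hthree : ∀ x a b c, a ≠ b → c ≠ a → c ≠ b → φ a x ≠ 0 → φ b x ≠ 0 → φ c x = 0 := by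
    intro x a b c hab hca hcb ha hb
    by_contra hc
    obtain ⟨y, -, hy⟩ := hcommon x x.2
    exact Set.eq_empty_iff_forall_notMem.1 (htriple a b c hab hca.symm hcb.symm) y
      ⟨⟨hy a (hφlt a x ha), hy b (hφlt b x hb)⟩, hy c (hφlt c x hc)⟩
  have hone : ∀ (x : X) (i : ι), (x : E) ∈ A i → ∃ j, (i = j ∨ G.Adj i j) ∧
      w x ∈ segment ℝ (vertexPoint i) (vertexPoint j) := by
    intro x i hi
    by_cases hj : ∃ j, j ≠ i ∧ φ j x ≠ 0
    · obtain ⟨j, hji, hj⟩ := hj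
      obtain ⟨y, -, hy⟩ := hcommon x x.2
      refine ⟨j, Or.inr (hG i j hji.symm ⟨y, hy i (hφlt i x (hφA i x hi)), hy j (hφlt j x hj)⟩),
        hseg x i j fun c hci hcj => hthree x i j c hji.symm hci hcj (hφA i x hi) hj⟩
    · push Not at hj
      exact ⟨i, Or.inl rfl, hseg x i i fun c hc _ => hj c hc⟩
  have hφc : ∀ i, Continuous (φ i) := fun i =>
    (continuous_const.sub ((Metric.continuous_infDist_pt (A i)).comp
      continuous_subtype_val)).max continuous_const
  refine ⟨⟨fun x => ⟨w x, ?_⟩, ?_⟩, hone, fun x i j hij hi hj =>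
    hseg x i j fun c hci hcj => hthree x i j c hij hci hcj (hφA i x hi) (hφA j x hj)⟩
  · obtain ⟨i, hi⟩ := Set.mem_iUnion.1 (hcov x.2)
    obtain ⟨j, hij, hj⟩ := hone x i hi
    exact ⟨i, j, hij, hj⟩
  · exact Continuous.subtype_mk (continuous_pi fun i => (hφc i).div
      (continuous_finsetSum _ fun i _ => hφc i) fun x => (hS x).ne') _

/-! ### Maps out of the subdivided graph -/

/-- Continuous functions which agree on the overlaps of a finite closed cover can be glued. -/
theorem exists_continuousMap_of_finite_closed_cover {X Y κ : Type*} [TopologicalSpace X]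
    [TopologicalSpace Y] [Finite κ] (C : κ → Set X) (hcl : ∀ k, IsClosed (C k))
    (hcov : ∀ x, ∃ k, x ∈ C k) (φ : κ → X → Y) (hφ : ∀ k, Continuous (φ k))
    (hagree : ∀ k l x, x ∈ C k → x ∈ C l → φ k x = φ l x) :
    ∃ f : C(X, Y), ∀ k, ∀ x ∈ C k, f x = φ k x := by
  choose κ' hκ' using hcov
  have h : ∀ k, ∀ x ∈ C k, φ (κ' x) x = φ k x := fun k x hx => hagree _ _ x (hκ' x) hx
  refine ⟨⟨fun x => φ (κ' x) x, ?_⟩, h⟩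
  refine (locallyFinite_of_finite C).continuous ?_ hcl fun k => ?_
  · exact Set.eq_univ_of_forall fun x => Set.mem_iUnion.2 ⟨κ' x, hκ' x⟩
  · exact (hφ k).continuousOn.congr (h k)

/-- Points for the vertices and paths for the half-edges determine a map from the subdivided
graph. -/
theorem exists_map_of_paths {V : Type v} [Finite V] {G : SimpleGraph V} {X : Type*}
    [TopologicalSpace X] (p : V → X) (q : G.edgeSet → X)
    (γ : ∀ (i : V) (e : G.edgeSet), i ∈ (e : Sym2 V) → Path (p i) (q e)) :
    ∃ f : C(graphSpace (subdividedGraph G), X),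
      (∀ (i : V) (x : graphSpace (subdividedGraph G)),
        (x : V ⊕ G.edgeSet → ℝ) = vertexPoint (Sum.inl i) → f x = p i) ∧
      ∀ (i : V) (e : G.edgeSet) (h : i ∈ (e : Sym2 V)) (x : graphSpace (subdividedGraph G)),
        (x : V ⊕ G.edgeSet → ℝ) ∈
          segment ℝ (vertexPoint (Sum.inl i)) (vertexPoint (Sum.inr e)) →
        f x = (γ i e h).extend ((x : V ⊕ G.edgeSet → ℝ) (Sum.inr e)) := by
  have hzero : ∀ (i : V) (e : G.edgeSet),
      vertexPoint (V := V ⊕ G.edgeSet) (Sum.inl i) (Sum.inr e) = 0 :=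
    fun i e => vertexPoint_of_ne (by simp)
  have hinj : ∀ i j : V, vertexPoint (V := V ⊕ G.edgeSet) (Sum.inl i) =
      vertexPoint (Sum.inl j) → i = j := by
    intro i j h
    by_contra hij
    have := congrFun h (Sum.inl i)
    rw [vertexPoint_self, vertexPoint_of_ne (by simpa)] at this
    exact one_ne_zero this
  have hvert : ∀ (i j : V) (e : G.edgeSet), vertexPoint (V := V ⊕ G.edgeSet) (Sum.inl i) ∈
      segment ℝ (vertexPoint (Sum.inl j)) (vertexPoint (Sum.inr e)) → i = j := by
    intro i j e hx
    by_contra hij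
    have := (mem_halfEdge_iff.1 hx).2.2.2.1 i hij
    rw [vertexPoint_self] at this
    exact one_ne_zero this
  let H := {k : V × G.edgeSet // k.1 ∈ (k.2 : Sym2 V)}
  obtain ⟨f, hf⟩ := exists_continuousMap_of_finite_closed_cover (κ := V ⊕ H)
    (X := graphSpace (subdividedGraph G)) (Y := X)
    (fun k => Subtype.val ⁻¹' Sum.elim (fun i => {vertexPoint (Sum.inl i)})
      (fun k : H => segment ℝ (vertexPoint (Sum.inl k.1.1)) (vertexPoint (Sum.inr k.1.2))) k)
    (by
      rintro (i | k)
      · exact isClosed_singleton.preimage continuous_subtype_val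
      · exact (isCompact_segment_vertexPoint _ _).isClosed.preimage continuous_subtype_val)
    (by
      intro x
      rcases mem_graphSpace_subdividedGraph_iff.1 x.2 with ⟨i, hx⟩ | ⟨i, e, hi, hx⟩
      · exact ⟨Sum.inl i, hx⟩
      · exact ⟨Sum.inr ⟨(i, e), hi⟩, hx⟩)
    (Sum.elim (fun i _ => p i)
      fun k x => (γ k.1.1 k.1.2 k.2).extend ((x : V ⊕ G.edgeSet → ℝ) (Sum.inr k.1.2)))
    (by
      rintro (i | k)
      · exact continuous_const
      · exact (γ _ _ k.2).continuous_extend.comp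
          ((continuous_apply _).comp continuous_subtype_val))
    (by
      rintro (i | ⟨⟨i, e⟩, hie⟩) (j | ⟨⟨j, e'⟩, hje⟩) ⟨x, hxG⟩ hx hy <;>
        simp only [Set.mem_preimage, Sum.elim_inl, Sum.elim_inr, Set.mem_singleton_iff]
          at hx hy ⊢
      · exact congrArg p (hinj i j (hx.symm.trans hy))
      · subst hx
        obtain rfl := hvert _ _ _ hy
        rw [hzero, Path.extend_zero]
      · subst hy
        obtain rfl := hvert _ _ _ hx
        rw [hzero, Path.extend_zero]
      · obtain ⟨h0, h1, hi, hl, hr⟩ := mem_halfEdge_iff.1 hx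
        obtain ⟨h0', h1', hi', hl', hr'⟩ := mem_halfEdge_iff.1 hy
        by_cases hij : i = j
        · subst hij
          by_cases hee : e = e'
          · subst hee; rfl
          · rw [hr' e hee, hr e' (Ne.symm hee), Path.extend_zero, Path.extend_zero]
        -- half-edges at distinct old vertices can meet only in a new vertex
        · have hxe : x (Sum.inr e) = 1 := by linarith [hl' i hij]
          have hee : e = e' := by
            by_contra hee
            linarith [hr' e hee]
          subst hee
          rw [hxe, Path.extend_one, Path.extend_one])
  exact ⟨f, fun i x hx => hf (Sum.inl i) x hx,
    fun i e hi x hx => hf (Sum.inr ⟨(i, e), hi⟩) x hx⟩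

/-! ### Injectivity on first homology -/

section Main

variable {ι E : Type v} [Fintype ι] [NormedAddCommGroup E] [NormedSpace ℝ E]
  {K : Geometry.SimplicialComplex ℝ E} {L : ι → Geometry.SimplicialComplex ℝ E}

/-- A map `f` with prescribed vertices exists, since each `|Kᵢ|` is path connected. -/
theorem exists_isIntersectionGraphMap (hfin : K.faces.Finite) (hL : ∀ i, (L i).faces ⊆ K.faces)
    (hconn : ∀ i, ConnectedSpace (L i).space) (p : ι → E)
    (q : (intersectionGraph L).edgeSet → E) (hp : ∀ i, p i ∈ (L i).space)
    (hq : ∀ (e : (intersectionGraph L).edgeSet) (i : ι), i ∈ (e : Sym2 ι) → q e ∈ (L i).space) :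
    ∃ f : C(SubdividedSpace L, K.space), IsIntersectionGraphMap L p q f := by
  have hsub : ∀ i, (L i).space ⊆ K.space := fun i => Set.biUnion_subset_biUnion_left (hL i)
  have hq' : ∀ e, q e ∈ K.space := fun e => hsub _ (hq e _ (Sym2.out_fst_mem _))
  have hpath : ∀ (i : ι) (e : (intersectionGraph L).edgeSet), i ∈ (e : Sym2 ι) →
      ∃ γ : Path (⟨p i, hsub i (hp i)⟩ : K.space) ⟨q e, hq' e⟩, ∀ t, (γ t : E) ∈ (L i).space := by
    intro i e hi
    have := pathConnectedSpace_space (L i) (hfin.subset (hL i))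
    obtain ⟨γ⟩ := PathConnectedSpace.joined (⟨p i, hp i⟩ : (L i).space) ⟨q e, hq e i hi⟩
    exact ⟨γ.map (continuous_inclusion (hsub i)), fun t => (γ t).2⟩
  choose γ hγ using hpath
  obtain ⟨f, hf, hf'⟩ := exists_map_of_paths _ _ γ
  refine ⟨f, ⟨fun i => ?_, fun e => ?_, fun i e hi x hx => ?_⟩⟩
  · rw [hf i _ rfl]
  · rw [hf' _ e (Sym2.out_fst_mem _) _ (right_mem_segment ℝ _ _)]
    simp only [newVertex, vertexPoint_self, Path.extend_one]
  · rw [hf' i e hi x hx]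
    exact hγ i e hi _

/-- The composite of `f` with a map from `|K|` to the intersection graph is the subdivision map, up
to homotopy. -/
theorem exists_comp_homotopic_subdivisionMap (hfin : K.faces.Finite)
    (hunion : K.faces = ⋃ i, (L i).faces)
    (htriple : ∀ i j k, i ≠ j → i ≠ k → j ≠ k → L i ⊓ L j ⊓ L k = ⊥)
    {p : ι → E} {q : (intersectionGraph L).edgeSet → E} (hp : ∀ i, p i ∈ (L i).space)
    (hq : ∀ (e : (intersectionGraph L).edgeSet) (i : ι), i ∈ (e : Sym2 ι) → q e ∈ (L i).space)
    {f : C(SubdividedSpace L, K.space)} (hf : IsIntersectionGraphMap L p q f) :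
    ∃ g : C(K.space, graphSpace (intersectionGraph L)),
      (g.comp f).Homotopic (subdivisionMap (intersectionGraph L)) := by
  have hL : ∀ i, (L i).faces ⊆ K.faces := fun i => hunion ▸ Set.subset_iUnion (fun i => (L i).faces) i
  have hcov : K.space ⊆ ⋃ i, (L i).space := by
    intro x hx
    obtain ⟨s, hs, hxs⟩ := Geometry.SimplicialComplex.mem_space_iff.1 hx
    rw [hunion] at hs
    obtain ⟨i, hi⟩ := Set.mem_iUnion.1 hs
    exact Set.mem_iUnion.2 ⟨i, Geometry.SimplicialComplex.mem_space_iff.2 ⟨s, hi, hxs⟩⟩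
  obtain ⟨g, hg, hg'⟩ := exists_map_to_graphSpace (isCompact_space K hfin)
    (fun i => (L i).space) (fun i => (isCompact_space (L i) (hfin.subset (hL i))).isClosed)
    (fun i => ⟨p i, hp i⟩) hcov
    (fun i j k hij hik hjk => inter_space_eq_empty (hL i) (hL j) (hL k) (htriple i j k hij hik hjk))
    (intersectionGraph L) fun i j hij h => ⟨hij, h⟩
  refine ⟨g, homotopic_subdivisionMap _ (fun x i hx => hg _ i ?_) fun x i j hij hx =>
    hg' _ i j hij.ne ?_ ?_⟩
  · rcases hx with hx | ⟨e, hi, hx⟩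
    · have : x = oldVertex L i := Subtype.ext hx
      rw [this, hf.map_oldVertex]
      exact hp i
    · exact hf.map_edge i e hi x hx
  all_goals
    have : x = newVertex L ⟨s(i, j), hij⟩ := Subtype.ext hx
    rw [this, hf.map_newVertex]
  · exact hq _ i (Sym2.mem_mk_left i j)
  · exact hq _ j (Sym2.mem_mk_right i j)

end Main

theorem lemmaA1 {ι E : Type v} [Fintype ι] [NormedAddCommGroup E] [NormedSpace ℝ E]
    (F : Type u) [Field F]
    (K : Geometry.SimplicialComplex ℝ E) (hfin : K.faces.Finite)
    (L : ι → Geometry.SimplicialComplex ℝ E)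
    (hunion : K.faces = ⋃ i, (L i).faces)
    (hnonempty : ∀ i, (L i).faces.Nonempty)
    (hconn : ∀ i, ConnectedSpace (L i).space)
    (htriple : ∀ i j k, i ≠ j → i ≠ k → j ≠ k → L i ⊓ L j ⊓ L k = ⊥) :
    -- the maps `f` exist, for any choice of the points
    (∀ (p : ι → E) (q : (intersectionGraph L).edgeSet → E),
      (∀ i, p i ∈ (L i).space) →
      (∀ (e : (intersectionGraph L).edgeSet) (i : ι), i ∈ (e : Sym2 ι) → q e ∈ (L i).space) →
        ∃ f : C(SubdividedSpace L, K.space), IsIntersectionGraphMap L p q f) ∧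
    -- subdivision induces an isomorphism `σ` on first homology, and `f_* ∘ σ⁻¹` is injective
    (∃ σ : H1 F (SubdividedSpace L) ≃ₗ[F] H1 F (graphSpace (intersectionGraph L)),
      σ.toLinearMap = H1map F (subdivisionMap (intersectionGraph L)) ∧
      ∀ (p : ι → E) (q : (intersectionGraph L).edgeSet → E)
        (f : C(SubdividedSpace L, K.space)),
        (∀ i, p i ∈ (L i).space) →
        (∀ (e : (intersectionGraph L).edgeSet) (i : ι), i ∈ (e : Sym2 ι) → q e ∈ (L i).space) →
        IsIntersectionGraphMap L p q f →
          Function.Injective (H1map F f ∘ₗ σ.symm.toLinearMap)) ∧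
    -- the inequality of ranks
    Module.rank F (H1 F (graphSpace (intersectionGraph L))) ≤ Module.rank F (H1 F K.space) := by
  have hL : ∀ i, (L i).faces ⊆ K.faces := fun i => hunion ▸ Set.subset_iUnion (fun i => (L i).faces) i
  have hexists := fun p q => exists_isIntersectionGraphMap (L := L) hfin hL hconn p q
  -- the subdivision map is a homeomorphism whose underlying map is `subdivisionMap` by definition
  let σ := H1equiv F (subdivisionHomeomorph (intersectionGraph L))
  have hσ : σ.toLinearMap = H1map F (subdivisionMap (intersectionGraph L)) := rfl
  have hinj : ∀ (p : ι → E) (q : (intersectionGraph L).edgeSet → E)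
      (f : C(SubdividedSpace L, K.space)), (∀ i, p i ∈ (L i).space) →
      (∀ (e : (intersectionGraph L).edgeSet) (i : ι), i ∈ (e : Sym2 ι) → q e ∈ (L i).space) →
      IsIntersectionGraphMap L p q f →
        Function.Injective (H1map F f ∘ₗ σ.symm.toLinearMap) := by
    intro p q f hp hq hf
    obtain ⟨g, hg⟩ := exists_comp_homotopic_subdivisionMap hfin hunion htriple hp hq hf
    have hgf : H1map F g ∘ₗ H1map F f = σ.toLinearMap := by
      rw [← H1map_comp, H1map_eq_of_homotopic F hg, hσ]
    refine Function.LeftInverse.injective (g := H1map F g) fun z => ?_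
    exact (LinearMap.congr_fun hgf (σ.symm z)).trans (σ.apply_symm_apply z)
  refine ⟨hexists, ⟨σ, hσ, hinj⟩, ?_⟩
  have hp : ∀ i, ∃ x, x ∈ (L i).space := fun i => by
    obtain ⟨s, hs⟩ := hnonempty i
    obtain ⟨x, hx⟩ := (L i).nonempty_of_mem_faces hs
    exact ⟨x, (L i).subset_space hs hx⟩
  have hq : ∀ e : (intersectionGraph L).edgeSet, ∃ x, ∀ i, i ∈ (e : Sym2 ι) → x ∈ (L i).space := by
    rintro ⟨⟨i, j⟩, h⟩
    obtain ⟨x, hxi, hxj⟩ := (show (intersectionGraph L).Adj i j from h).2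
    refine ⟨x, fun k hk => ?_⟩
    rcases Sym2.mem_iff.1 hk with rfl | rfl
    exacts [hxi, hxj]
  choose p hp using hp
  choose q hq using hq
  obtain ⟨f, hf⟩ := hexists p q hp hq
  exact LinearMap.rank_le_of_injective _ (hinj p q f hp hq hf)
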